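/- Proposition. Let $Z_1,Z_2,\ldots$ be independent standard real Gaussian random variables, let $a:=\mathbb{E}\log|Z_1|$, let $W_i:=\log|Z_i|-a$, and let $L_1,L_2,\ldots$ be independent symmetric exponential random variables, i.e. with density $\frac12 e^{-|t|}$ on $\mathbb{R}$. For a random variable $R$ and $p\geq 1$ write $\|R\|_p:=(\mathbb{E}|R|^p)^{1/p}$. For $x\in\mathbb{R}^n$ let $x^*_1\geq\cdots\geq x^*_n$ be the non-increasing rearrangement of $|x_1|,\ldots,|x_n|$, and for a real number $s\geq 1$ let $x^s\in\mathbb{R}^n$ be the vector whose $i$-th entry is $x^*_i$ if $i\leq s$ and $0$ otherwise, and $x_s\in\mathbb{R}^n$ the vector whose $i$-th entry is $0$ if $i\leq s$ and $x^*_i$ otherwise. Then there exist two universal constants $C_1,C_2>0$ such that for every integer $n\geq 1$, every real $p\geq 1$ and every $\theta=(\theta_1,\ldots,\theta_n)$ in the Euclidean unit sphere $S^{n-1}\subset\mathbb{R}^n$, the random variable $\langle W,\theta\rangle=\sum_{i=1}^n\theta_iW_i$ has finite $p$-th absolute moment and $$C_1\,p\,\|\theta^p\|_\infty+C_1\sqrt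 p\,\|\theta_p\|_2\ \leq\ \|\langle W,\theta\rangle\|_p\ \leq\ C_2\,p\,\|\theta^p\|_\infty+C_2\sqrt p\,\|\theta_p\|_2 .$$ The same holds, with the same constants, for $\langle L,\theta\rangle=\sum_{i=1}^n\theta_iL_i$ in place of $\langle W,\theta\rangle$. -/

import Mathlib

open MeasureTheory ProbabilityTheory

noncomputable section

/-- The non-increasing rearrangement `x^*` of `(|x₁|, …, |xₙ|)`; the entry written `x^*_i` with
`1 ≤ i ≤ n` is `decreasingRearrangement x ⟨i - 1, _⟩`. -/
def decreasingRearrangement {n : ℕ} (x : EuclideanSpace ℝ (Fin n)) : EuclideanSpace ℝ (Fin n) :=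
  WithLp.toLp 2 fun i => |x (Tuple.sort (fun j => -|x j|) i)|

theorem decreasingRearrangement_antitone {n : ℕ} (x : EuclideanSpace ℝ (Fin n)) :
    Antitone fun i => decreasingRearrangement x i := by
  intro i j hij
  have h := Tuple.monotone_sort (fun j => -|x j|) hij
  simp only [Function.comp] at h
  simp only [decreasingRearrangement]
  linarith

/-- The vector `x^s`: its `i`-th entry (counting from `1`) is `x^*_i` for `i ≤ s`, and `0`
otherwise. -/
def headPart {n : ℕ} (x : EuclideanSpace ℝ (Fin n)) (s : ℝ) : EuclideanSpace ℝ (Fin n) :=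
  open Classical in
  WithLp.toLp 2 fun i => if ((i : ℕ) : ℝ) + 1 ≤ s then decreasingRearrangement x i else 0

/-- The vector `x_s`: its `i`-th entry (counting from `1`) is `0` for `i ≤ s`, and `x^*_i`
otherwise. -/
def tailPart {n : ℕ} (x : EuclideanSpace ℝ (Fin n)) (s : ℝ) : EuclideanSpace ℝ (Fin n) :=
  open Classical in
  WithLp.toLp 2 fun i => if ((i : ℕ) : ℝ) + 1 ≤ s then 0 else decreasingRearrangement x i

/-- The sup norm `‖x‖_∞` on `ℝⁿ` (the norm of `Fin n → ℝ`). -/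
def supNorm {n : ℕ} (x : EuclideanSpace ℝ (Fin n)) : ℝ := ‖WithLp.ofLp x‖

/-- `‖R‖_p = (𝔼 |R|^p)^{1/p}`. -/
def momentNorm {Ω : Type*} [MeasurableSpace Ω] (μ : Measure Ω) (R : Ω → ℝ) (p : ℝ) : ℝ :=
  (∫ ω, |R ω| ^ p ∂μ) ^ (1 / p)

/-- `a = 𝔼 log |Z|` for a standard real Gaussian `Z`. -/
def meanLogAbsGaussian : ℝ := ∫ z, Real.log |z| ∂(gaussianReal 0 1)

/-- The law of a symmetric exponential random variable: density `e^{-|t|} / 2` on `ℝ`. -/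
def symmetricExponential : Measure ℝ :=
  volume.withDensity fun t => ENNReal.ofReal (1 / 2 * Real.exp (-|t|))

end

/-!
The summands `X = W_i` and `X = L_i` share two features: they are centred with
`exp (c l²) ≤ 𝔼 exp (l X) ≤ exp (l² / c)` for `|l| ≤ c`, as for any centred nonconstant variable
whose moment generating function is finite near `0`, and `ℙ (|X| ≥ t) ≥ c exp (-t / c)`. Everything
follows from these. By independence, `S = ∑ θ_i X_i` satisfies
`exp (c t² ‖θ‖²) ≤ 𝔼 exp (t S) ≤ exp (t² ‖θ‖² / c)` for `|t| ‖θ‖_∞ ≤ c`.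

* Upper bound: `|x| ^ p ≤ (p / t) ^ p * exp |t x|`, with `1 / t = ‖θ‖_∞ / c + ‖θ‖ / √p`.
* Lower bound by `p ‖θ‖_∞`: averaging out all but one summand decreases `‖S‖_p` by Jensen's
  inequality, and the remaining `θ_j X_j` is of size at least `p |θ_j|` with probability at least
  `c exp (-p / c)`.
* Lower bound by `√p ‖θ‖`: unless `√p ‖θ‖` is itself of order at most `p ‖θ‖_∞`, one may take `t`
  of order `√p / ‖θ‖`, for which the Paley–Zygmund inequality applied to `exp (t S)` shows that
  `S ≥ p / t` with probability at least `exp (-D p) / 4`, where `D` depends only on `c`.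

Finally `‖θ^p‖_∞ = ‖θ‖_∞`, and `‖θ‖` differs from `‖θ_p‖` by at most `‖θ^p‖ ≤ √p ‖θ‖_∞`, so that
`p ‖θ‖_∞ + √p ‖θ‖` and `p ‖θ^p‖_∞ + √p ‖θ_p‖` agree up to a factor `2`.
-/

section Rearrangement

variable {n : ℕ} (x : EuclideanSpace ℝ (Fin n)) (s : ℝ)

theorem abs_apply_eq_decreasingRearrangement (i : Fin n) :
    |x i| = decreasingRearrangement x ((Tuple.sort fun j => -|x j|).symm i) := by
  simp [decreasingRearrangement]

theorem norm_decreasingRearrangement : ‖decreasingRearrangement x‖ = ‖x‖ := by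
  simp only [EuclideanSpace.norm_eq, decreasingRearrangement, Real.norm_eq_abs, abs_abs]
  rw [Equiv.sum_comp (Tuple.sort fun j => -|x j|) fun i => |x i| ^ 2]

theorem supNorm_nonneg : 0 ≤ supNorm x :=
  norm_nonneg _

theorem abs_apply_le_supNorm (i : Fin n) : |x i| ≤ supNorm x :=
  norm_le_pi_norm (WithLp.ofLp x) i

theorem supNorm_headPart {s : ℝ} (hs : 1 ≤ s) : supNorm (headPart x s) = supNorm x := by
  apply le_antisymm
  · refine (pi_norm_le_iff_of_nonneg (supNorm_nonneg x)).2 fun i => ?_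
    simp only [headPart]
    split_ifs
    · simpa [decreasingRearrangement] using abs_apply_le_supNorm x _
    · simpa using supNorm_nonneg x
  · refine (pi_norm_le_iff_of_nonneg (supNorm_nonneg _)).2 fun i => ?_
    calc |x i| = decreasingRearrangement x ((Tuple.sort fun j => -|x j|).symm i) :=
          abs_apply_eq_decreasingRearrangement x i
      _ ≤ decreasingRearrangement x ⟨0, i.pos⟩ :=
          decreasingRearrangement_antitone x (Nat.zero_le _)
      _ ≤ |headPart x s ⟨0, i.pos⟩| := by simp [headPart, hs, le_abs_self]
      _ ≤ supNorm (headPart x s) := abs_apply_le_supNorm _ _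

theorem headPart_add_tailPart : headPart x s + tailPart x s = decreasingRearrangement x := by
  ext i
  simp only [headPart, tailPart, PiLp.add_apply]
  split_ifs <;> simp

theorem norm_tailPart_le : ‖tailPart x s‖ ≤ ‖x‖ := by
  rw [← norm_decreasingRearrangement x, EuclideanSpace.norm_eq, EuclideanSpace.norm_eq]
  gcongr with i
  simp only [tailPart]
  split_ifs <;> simp

theorem card_filter_add_one_le {s : ℝ} (hs : 0 ≤ s) :
    ((Finset.univ.filter fun i : Fin n => ((i : ℕ) : ℝ) + 1 ≤ s).card : ℝ) ≤ s := by
  refine le_trans (Nat.cast_le.2 ?_) (Nat.floor_le hs)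
  rw [← Finset.card_range ⌊s⌋₊]
  refine Finset.card_le_card_of_injOn (fun i => (i : ℕ)) (fun i hi => ?_) Fin.val_injective.injOn
  have hi' : ((i : ℕ) : ℝ) + 1 ≤ s := by simpa using hi
  have : (i : ℕ) + 1 ≤ ⌊s⌋₊ := Nat.le_floor (by exact_mod_cast hi')
  simpa using this

theorem norm_headPart_le {s : ℝ} (hs : 0 ≤ s) :
    ‖headPart x s‖ ≤ √s * supNorm (headPart x s) := by
  let I := Finset.univ.filter fun i : Fin n => ((i : ℕ) : ℝ) + 1 ≤ s
  have hI : ∀ i, ‖headPart x s i‖ ^ 2 ≠ 0 → i ∈ I := fun i hi => by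
    by_contra h
    exact hi (by simp_all [headPart, I])
  have hsq : ∑ i, ‖headPart x s i‖ ^ 2 ≤ s * supNorm (headPart x s) ^ 2 :=
    calc ∑ i, ‖headPart x s i‖ ^ 2 = ∑ i ∈ I, ‖headPart x s i‖ ^ 2 :=
          (Finset.sum_subset I.subset_univ fun i _ hi => not_not.1 (mt (hI i) hi)).symm
      _ ≤ I.card • supNorm (headPart x s) ^ 2 :=
          Finset.sum_le_card_nsmul _ _ _ fun i _ => by
            gcongr
            exact abs_apply_le_supNorm _ i
      _ ≤ s * supNorm (headPart x s) ^ 2 := by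
          rw [nsmul_eq_mul]
          gcongr
          exact card_filter_add_one_le hs
  calc ‖headPart x s‖ ≤ √(s * supNorm (headPart x s) ^ 2) := by
        rw [EuclideanSpace.norm_eq]
        gcongr
    _ = √s * supNorm (headPart x s) := by
        rw [Real.sqrt_mul hs, Real.sqrt_sq (supNorm_nonneg _)]

theorem norm_le_sqrt_mul_supNorm_add_norm_tailPart {s : ℝ} (hs : 1 ≤ s) :
    ‖x‖ ≤ √s * supNorm x + ‖tailPart x s‖ := by
  rw [← norm_decreasingRearrangement, ← headPart_add_tailPart x s, ← supNorm_headPart x hs]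
  exact (norm_add_le _ _).trans (by gcongr; exact norm_headPart_le x (by linarith))

end Rearrangement

section MomentNorm

variable {Ω : Type*} [MeasurableSpace Ω] {μ : Measure Ω} {R X Y : Ω → ℝ} {p : ℝ}

theorem momentNorm_eq_lpNorm (hR : AEStronglyMeasurable R μ) (hp : 0 < p) :
    momentNorm μ R p = lpNorm R (ENNReal.ofReal p) μ := by
  rw [lpNorm_eq_integral_norm_rpow_toReal (by simpa using hp) (by simp) hR,
    ENNReal.toReal_ofReal hp.le, momentNorm, one_div]
  rfl

theorem momentNorm_congr_ae (h : X =ᵐ[μ] Y) : momentNorm μ X p = momentNorm μ Y p := by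
  unfold momentNorm
  congr 1
  exact integral_congr_ae (h.fun_comp fun x => |x| ^ p)

theorem momentNorm_const_mul (hp : 0 < p) (c : ℝ) :
    momentNorm μ (fun ω => c * R ω) p = |c| * momentNorm μ R p := by
  simp only [momentNorm, abs_mul]
  simp_rw [Real.mul_rpow (abs_nonneg _) (abs_nonneg _)]
  rw [integral_const_mul, Real.mul_rpow (by positivity) (by positivity),
    ← Real.rpow_mul (abs_nonneg c), mul_one_div_cancel hp.ne', Real.rpow_one]

theorem mul_le_momentNorm_of_rpow_le_measureReal (hp : 0 < p)
    (hR : MemLp R (ENNReal.ofReal p) μ) {t q : ℝ} (ht : 0 ≤ t) (hq : 0 ≤ q)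
    (h : q ^ p ≤ μ.real {ω | t ≤ |R ω|}) : t * q ≤ momentNorm μ R p := by
  have hint : Integrable (fun ω => |R ω| ^ p) μ := by
    simpa [ENNReal.toReal_ofReal hp.le] using hR.integrable_norm_rpow (by simpa using hp) (by simp)
  have hmarkov : (t * q) ^ p ≤ ∫ ω, |R ω| ^ p ∂μ :=
    calc (t * q) ^ p = t ^ p * q ^ p := Real.mul_rpow ht hq
      _ ≤ t ^ p * μ.real {ω | t ≤ |R ω|} := by gcongr
      _ = t ^ p * μ.real {ω | t ^ p ≤ |R ω| ^ p} := by
          simp_rw [Real.rpow_le_rpow_iff ht (abs_nonneg _) hp]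
      _ ≤ ∫ ω, |R ω| ^ p ∂μ :=
          mul_meas_ge_le_integral_of_nonneg (ae_of_all _ fun ω => by positivity) hint _
  rw [momentNorm, one_div]
  exact (Real.le_rpow_inv_iff_of_pos (by positivity) (by positivity) hp).2 hmarkov

theorem condExp_comap_add_of_indepFun [IsProbabilityMeasure μ] (hXm : Measurable X)
    (hYm : Measurable Y) (hX : Integrable X μ) (hY : Integrable Y μ) (hXY : IndepFun X Y μ)
    (hY0 : ∫ ω, Y ω ∂μ = 0) :
    μ[X + Y | MeasurableSpace.comap X inferInstance] =ᵐ[μ] X := by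
  have hcondX : μ[X | MeasurableSpace.comap X inferInstance] = X :=
    condExp_of_stronglyMeasurable hXm.comap_le (comap_measurable X).stronglyMeasurable hX
  have hcondY : μ[Y | MeasurableSpace.comap X inferInstance] =ᵐ[μ] fun _ => 0 := hY0 ▸
    condExp_indep_eq hYm.comap_le hXm.comap_le (comap_measurable Y).stronglyMeasurable hXY.symm
  filter_upwards [condExp_add hX hY (MeasurableSpace.comap X inferInstance), hcondY]
    with ω hadd hzero
  rw [hadd, Pi.add_apply, hzero, hcondX, add_zero]

theorem momentNorm_le_momentNorm_add [IsProbabilityMeasure μ] (hp : 1 ≤ p)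
    (hX : MemLp X (ENNReal.ofReal p) μ) (hY : MemLp Y (ENNReal.ofReal p) μ)
    (hXY : IndepFun X Y μ) (hY0 : ∫ ω, Y ω ∂μ = 0) :
    momentNorm μ X p ≤ momentNorm μ (X + Y) p := by
  have hp1 : 1 ≤ ENNReal.ofReal p := by simpa using hp
  obtain ⟨X', hX'm, hXX'⟩ := hX.1
  obtain ⟨Y', hY'm, hYY'⟩ := hY.1
  have hX' := hX.ae_eq hXX'
  have hY' := hY.ae_eq hYY'
  have hcond := condExp_comap_add_of_indepFun hX'm.measurable hY'm.measurable
    (hX'.integrable hp1) (hY'.integrable hp1) (hXY.congr hXX' hYY')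
    (by rw [← integral_congr_ae hYY', hY0])
  have hp0 : 0 < p := by linarith
  calc momentNorm μ X p
      = momentNorm μ μ[X' + Y' | MeasurableSpace.comap X' inferInstance] p :=
        momentNorm_congr_ae (hXX'.trans hcond.symm)
    _ ≤ momentNorm μ (X' + Y') p := by
        rw [momentNorm_eq_lpNorm ((hX'.add hY').condExp hp1).1 hp0,
          momentNorm_eq_lpNorm (hX'.add hY').1 hp0]
        exact (hX'.add hY').lpNorm_condExp_le_lpNorm hp1
    _ = momentNorm μ (X + Y) p := momentNorm_congr_ae (hXX'.add hYY').symm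

end MomentNorm

section ExponentialMoments

variable {Ω : Type*} [MeasurableSpace Ω] {μ : Measure Ω} {f R : Ω → ℝ} {p t D : ℝ}

theorem momentNorm_le_of_mgf_le (hp : 1 ≤ p) (ht : 0 < t)
    (hint : Integrable (fun ω => Real.exp (t * R ω)) μ)
    (hint' : Integrable (fun ω => Real.exp (-t * R ω)) μ)
    (hmgf : mgf R μ t ≤ Real.exp (D * p)) (hmgf' : mgf R μ (-t) ≤ Real.exp (D * p)) :
    momentNorm μ R p ≤ 2 * Real.exp D * (p / t) := by
  have hp0 : 0 < p := by linarith
  have hmoment : ∫ ω, |R ω| ^ p ∂μ ≤ (p / t * (2 * Real.exp D)) ^ p :=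
    calc ∫ ω, |R ω| ^ p ∂μ
        ≤ ∫ ω, (p / t) ^ p * (Real.exp (t * R ω) + Real.exp (-t * R ω)) ∂μ := by
          refine integral_mono (integrable_rpow_abs_of_integrable_exp_mul ht.ne' hint hint' hp0.le)
            ((hint.add hint').const_mul _) fun ω => ?_
          refine (rpow_abs_le_mul_max_exp_of_pos (R ω) hp0.le ht).trans ?_
          gcongr
          exact max_le_add_of_nonneg (Real.exp_pos _).le (Real.exp_pos _).le
      _ = (p / t) ^ p * (mgf R μ t + mgf R μ (-t)) := by
          rw [integral_const_mul, integral_add hint hint']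
          rfl
      _ ≤ (p / t) ^ p * (2 ^ p * Real.exp (D * p)) := by
          gcongr
          linarith [mul_le_mul_of_nonneg_right (Real.self_le_rpow_of_one_le one_le_two hp)
            (Real.exp_pos (D * p)).le]
      _ = (p / t * (2 * Real.exp D)) ^ p := by
          rw [Real.exp_mul, ← Real.mul_rpow, ← Real.mul_rpow] <;> positivity
  calc momentNorm μ R p ≤ p / t * (2 * Real.exp D) := by
        rw [momentNorm, one_div]
        exact (Real.rpow_inv_le_iff_of_pos (by positivity) (by positivity) hp0).2 hmoment
    _ = 2 * Real.exp D * (p / t) := mul_comm _ _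

theorem le_div_mul_sq_add_div {a b : ℝ} (ha : 0 < a) (hb : 0 < b) (x : ℝ) :
    x ≤ a / (4 * b) * x ^ 2 + b / a := by
  have hsq : 0 ≤ a / (4 * b) * (x - 2 * b / a) ^ 2 := by positivity
  have hexpand : a / (4 * b) * (x - 2 * b / a) ^ 2 = a / (4 * b) * x ^ 2 - x + b / a := by
    field_simp
    ring
  linarith

variable [IsProbabilityMeasure μ]

theorem paley_zygmund_half (hf : MemLp f 2 μ) (hf0 : 0 ≤ ∫ ω, f ω ∂μ) :
    (∫ ω, f ω ∂μ) ^ 2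
      ≤ 4 * (∫ ω, f ω ^ 2 ∂μ) * μ.real {ω | (∫ ω, f ω ∂μ) / 2 ≤ f ω} := by
  set m := ∫ ω, f ω ∂μ
  set V := ∫ ω, f ω ^ 2 ∂μ
  set A := {ω | m / 2 ≤ f ω}
  rcases hf0.eq_or_lt with hm | hm
  · rw [← hm, zero_pow two_ne_zero]
    positivity
  have hmV : m ^ 2 ≤ V := by
    simpa [variance_eq_sub hf] using variance_nonneg f μ
  have hV : 0 < V := (by positivity : 0 < m ^ 2).trans_le hmV
  have hA : NullMeasurableSet A μ := nullMeasurableSet_le aemeasurable_const hf.1.aemeasurable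
  have hAint : Integrable (fun ω => V / m * A.indicator 1 ω) μ :=
    ((integrable_const (1 : ℝ)).indicator₀ hA).const_mul _
  have hsqint : Integrable (fun ω => m / (4 * V) * f ω ^ 2) μ := hf.integrable_sq.const_mul _
  have hsum : Integrable (fun ω => m / (4 * V) * f ω ^ 2 + V / m * A.indicator 1 ω) μ :=
    hsqint.add hAint
  have hpointwise : ∀ ω, f ω ≤ m / (4 * V) * f ω ^ 2 + V / m * A.indicator 1 ω + m / 2 := by
    intro ω
    by_cases hω : m / 2 ≤ f ω
    · rw [Set.indicator_of_mem (show ω ∈ A from hω), Pi.one_apply]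
      linarith [le_div_mul_sq_add_div hm hV (f ω)]
    · have hsq : 0 ≤ m / (4 * V) * f ω ^ 2 := by positivity
      rw [Set.indicator_of_notMem (show ω ∉ A from hω)]
      linarith
  have hmean : m ≤ m / (4 * V) * V + V / m * μ.real A + m / 2 :=
    calc m ≤ ∫ ω, (m / (4 * V) * f ω ^ 2 + V / m * A.indicator 1 ω + m / 2) ∂μ :=
          integral_mono (hf.integrable one_le_two) (hsum.add (integrable_const _)) hpointwise
      _ = m / (4 * V) * V + V / m * μ.real A + m / 2 := by
          rw [integral_add hsum (integrable_const _), integral_add hsqint hAint,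
            integral_const_mul, integral_const_mul, integral_indicator₀ hA]
          simp [V]
  field_simp at hmean
  linarith

theorem exp_div_four_le_measureReal_of_mgf (hp : 1 ≤ p) (ht : 0 < t)
    (hint : Integrable (fun ω => Real.exp (2 * t * R ω)) μ)
    (hmgf : Real.exp (2 * p) ≤ mgf R μ t) (hmgf' : mgf R μ (2 * t) ≤ Real.exp (D * p)) :
    Real.exp (-(D * p)) / 4 ≤ μ.real {ω | p / t ≤ |R ω|} := by
  have hexp_sq : ∀ ω, Real.exp (t * R ω) ^ 2 = Real.exp (2 * t * R ω) := fun ω => by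
    rw [← Real.exp_nat_mul]
    push_cast
    ring_nf
  have hRm : AEMeasurable R μ :=
    aemeasurable_of_integrable_exp_mul (v := 0) (by positivity) hint (by simp)
  have hmem : MemLp (fun ω => Real.exp (t * R ω)) 2 μ :=
    (memLp_two_iff_integrable_sq (by fun_prop)).2 (by simpa only [hexp_sq] using hint)
  have hsubset : {ω | mgf R μ t / 2 ≤ Real.exp (t * R ω)} ⊆ {ω | p / t ≤ |R ω|} := fun ω hω => by
    have hexp : Real.exp p ≤ Real.exp (t * R ω) :=
      calc Real.exp p ≤ Real.exp (2 * p) / 2 := by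
            rw [two_mul, Real.exp_add]
            nlinarith [Real.add_one_le_exp p, Real.exp_pos p]
        _ ≤ mgf R μ t / 2 := by gcongr
        _ ≤ Real.exp (t * R ω) := hω
    calc p / t ≤ R ω := (div_le_iff₀' ht).2 (Real.exp_le_exp.1 hexp)
      _ ≤ |R ω| := le_abs_self _
  have hpz : 1 ≤ 4 * Real.exp (D * p) * μ.real {ω | p / t ≤ |R ω|} :=
    calc 1 ≤ mgf R μ t ^ 2 := one_le_pow₀ ((Real.one_le_exp (by linarith)).trans hmgf)
      _ ≤ 4 * mgf R μ (2 * t) * μ.real {ω | mgf R μ t / 2 ≤ Real.exp (t * R ω)} := by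
          simpa only [hexp_sq, mgf] using paley_zygmund_half hmem mgf_nonneg
      _ ≤ 4 * Real.exp (D * p) * μ.real {ω | p / t ≤ |R ω|} := by
          gcongr
          exact measure_ne_top _ _
  rw [Real.exp_neg, inv_eq_one_div, div_div, div_le_iff₀ (by positivity)]
  linarith

theorem le_momentNorm_of_mgf (hp : 1 ≤ p) (hR : MemLp R (ENNReal.ofReal p) μ) (ht : 0 < t)
    (hint : Integrable (fun ω => Real.exp (2 * t * R ω)) μ)
    (hmgf : Real.exp (2 * p) ≤ mgf R μ t) (hmgf' : mgf R μ (2 * t) ≤ Real.exp (D * p)) :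
    p / t * (Real.exp (-D) / 4) ≤ momentNorm μ R p := by
  refine mul_le_momentNorm_of_rpow_le_measureReal (by linarith) hR (by positivity) (by positivity)
    ?_
  calc (Real.exp (-D) / 4) ^ p = Real.exp (-(D * p)) * (1 / 4) ^ p := by
        rw [div_eq_mul_one_div, Real.mul_rpow (by positivity) (by norm_num), ← Real.exp_mul,
          neg_mul]
    _ ≤ Real.exp (-(D * p)) * (1 / 4) := by
        gcongr
        exact Real.rpow_le_self_of_le_one (by norm_num) (by norm_num) hp
    _ = Real.exp (-(D * p)) / 4 := mul_one_div _ _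
    _ ≤ μ.real {ω | p / t ≤ |R ω|} := exp_div_four_le_measureReal_of_mgf hp ht hint hmgf hmgf'

end ExponentialMoments

/-- `X` is of exponential type with constant `c` under `μ`: it is centred, its moment generating
function behaves like that of a Gaussian on `[-c, c]`, and its tails are at least exponential.
A single constant plays the role of radius, of both variance factors and of the tail parameters. -/
structure IsExponentialType {Ω : Type*} [MeasurableSpace Ω] (X : Ω → ℝ) (c : ℝ)
    (μ : Measure Ω) : Prop where
  pos : 0 < c
  integral_eq_zero : ∫ ω, X ω ∂μ = 0
  integrable_exp_mul : ∀ l, |l| ≤ c → Integrable (fun ω => Real.exp (l * X ω)) μ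
  le_mgf : ∀ l, |l| ≤ c → Real.exp (c * l ^ 2) ≤ mgf X μ l
  mgf_le : ∀ l, |l| ≤ c → mgf X μ l ≤ Real.exp (l ^ 2 / c)
  le_tail : ∀ t, 0 ≤ t → c * Real.exp (-(t / c)) ≤ μ.real {ω | t ≤ |X ω|}

section Criterion

open Filter Topology Asymptotics

theorem eventually_forall_abs_le {P : ℝ → Prop} (hP : ∀ᶠ l in 𝓝 0, P l) :
    ∀ᶠ c in 𝓝[>] 0, ∀ l, |l| ≤ c → P l := by
  obtain ⟨ε, hε, hball⟩ := Metric.eventually_nhds_iff.1 hP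
  filter_upwards [Ioo_mem_nhdsGT hε] with c hc l hl
  exact hball (by simpa using hl.trans_lt hc.2)

variable {Ω : Type*} [MeasurableSpace Ω] {μ : Measure Ω} [IsProbabilityMeasure μ] {X : Ω → ℝ}

theorem cgf_sub_variance_isLittleO (hint : 0 ∈ interior (integrableExpSet X μ))
    (hX0 : ∫ ω, X ω ∂μ = 0) :
    (fun l => cgf X μ l - Var[X; μ] / 2 * l ^ 2) =o[𝓝 0] fun l => l ^ 2 := by
  have hderiv : deriv (cgf X μ) 0 = 0 := by rw [deriv_cgf_zero hint, hX0, zero_div]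
  have hderiv2 : iteratedDeriv 2 (cgf X μ) 0 = Var[X; μ] := by
    rw [← variance_tilted_mul hint]
    simp [tilted_const']
  have htaylor := taylor_isLittleO (n := 2) convex_integrableExpSet.interior hint
    (analyticOnNhd_cgf.contDiffOn isOpen_interior.uniqueDiffOn)
  rw [isOpen_interior.nhdsWithin_eq hint] at htaylor
  refine (htaylor.congr (fun l => ?_) fun l => ?_)
  · simp only [taylorWithinEval_succ, taylor_within_zero_eval, cgf_zero, CharP.cast_eq_zero,
      zero_add, Nat.factorial_zero, Nat.cast_one, mul_one, inv_one, sub_zero, pow_one, one_mul,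
      iteratedDerivWithin_of_isOpen isOpen_interior hint, iteratedDeriv_one, hderiv, smul_eq_mul,
      mul_zero, add_zero, Nat.factorial_one, Nat.reduceAdd, hderiv2, sub_right_inj]
    ring
  · rw [sub_zero]

theorem eventually_mgf_mem_Icc (hint : 0 ∈ interior (integrableExpSet X μ))
    (hX0 : ∫ ω, X ω ∂μ = 0) (hvar : 0 < Var[X; μ]) :
    ∀ᶠ l in 𝓝 0, mgf X μ l ∈
      Set.Icc (Real.exp (Var[X; μ] / 4 * l ^ 2)) (Real.exp (Var[X; μ] * l ^ 2)) := by
  have hlittle := (cgf_sub_variance_isLittleO hint hX0).bound (by positivity : 0 < Var[X; μ] / 4)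
  filter_upwards [hlittle, mem_interior_iff_mem_nhds.1 hint] with l hl hlint
  rw [Real.norm_eq_abs, Real.norm_eq_abs, abs_of_nonneg (sq_nonneg l), abs_le] at hl
  rw [← exp_cgf hlint]
  have : 0 ≤ Var[X; μ] * l ^ 2 := by positivity
  constructor <;> gcongr <;> linarith

theorem variance_pos_of_measureReal_pos (hX : MemLp X 2 μ) (hX0 : ∫ ω, X ω ∂μ = 0) {t : ℝ}
    (ht : 0 < t) (htail : 0 < μ.real {ω | t ≤ |X ω|}) : 0 < Var[X; μ] := by
  refine (variance_nonneg X μ).lt_of_ne' fun hvar => htail.ne' ?_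
  have hX_ae : ∀ᵐ ω ∂μ, ¬ t ≤ |X ω| := by
    filter_upwards [ae_eq_integral_of_variance_eq_zero hX hvar] with ω hω
    rw [hω, hX0, abs_zero]
    exact ht.not_ge
  rw [measureReal_eq_zero_iff]
  simpa [ae_iff] using hX_ae

theorem eventually_isExponentialType (hint : 0 ∈ interior (integrableExpSet X μ))
    (hX0 : ∫ ω, X ω ∂μ = 0) {c₀ r : ℝ} (hc₀ : 0 < c₀)
    (htail : ∀ t, 0 ≤ t → c₀ * Real.exp (-(r * t)) ≤ μ.real {ω | t ≤ |X ω|}) :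
    ∀ᶠ c in 𝓝[>] 0, IsExponentialType X c μ := by
  have hvar : 0 < Var[X; μ] := variance_pos_of_measureReal_pos
    (by simpa using memLp_of_mem_interior_integrableExpSet hint 2) hX0 one_pos
    ((by positivity : 0 < c₀ * Real.exp (-(r * 1))).trans_le (htail 1 zero_le_one))
  have hinv : Tendsto (fun c : ℝ => c⁻¹) (𝓝[>] 0) atTop := tendsto_inv_nhdsGT_zero
  filter_upwards [self_mem_nhdsWithin,
    eventually_forall_abs_le (mem_interior_iff_mem_nhds.1 hint),
    eventually_forall_abs_le (eventually_mgf_mem_Icc hint hX0 hvar),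
    Ioo_mem_nhdsGT (by positivity : 0 < Var[X; μ] / 4), Ioo_mem_nhdsGT hc₀,
    hinv.eventually_ge_atTop Var[X; μ], hinv.eventually_ge_atTop r]
    with c hc hexp hmgf hcvar hcc₀ hvarc hrc
  have hc : 0 < c := hc
  refine ⟨hc, hX0, hexp, fun l hl => le_trans ?_ (hmgf l hl).1, fun l hl => (hmgf l hl).2.trans ?_,
    fun t ht => le_trans ?_ (htail t ht)⟩
  · gcongr
    exact hcvar.2.le
  · rw [div_eq_inv_mul]
    gcongr
  · rw [div_eq_inv_mul]
    gcongr
    exact hcc₀.2.le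

end Criterion

theorem IsExponentialType.comp_hasLaw {Ω 𝓧 : Type*} [MeasurableSpace Ω] [MeasurableSpace 𝓧]
    {μ : Measure Ω} {ν : Measure 𝓧} {f : 𝓧 → ℝ} {c : ℝ} (hf : IsExponentialType f c ν)
    (hfm : Measurable f) {Y : Ω → 𝓧} (hY : HasLaw Y ν μ) :
    IsExponentialType (fun ω => f (Y ω)) c μ := by
  have hmgf : mgf (fun ω => f (Y ω)) μ = mgf f ν := by
    ext l
    exact hY.integral_comp (f := fun x => Real.exp (l * f x)) (by fun_prop)
  refine ⟨hf.pos, ?_, fun l hl => ?_, hmgf ▸ hf.le_mgf, hmgf ▸ hf.mgf_le, fun t ht => ?_⟩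
  · rw [← hf.integral_eq_zero]
    exact hY.integral_comp hfm.aestronglyMeasurable
  · have h := hf.integrable_exp_mul l hl
    rw [← hY.map_eq] at h
    exact h.comp_aemeasurable hY.aemeasurable
  · refine (hf.le_tail t ht).trans_eq ?_
    exact (hY.measureReal_eq (measurableSet_le measurable_const hfm.abs)).symm

section WeightedSum

variable {Ω : Type*} [MeasurableSpace Ω] {μ : Measure Ω} {c p t : ℝ}

theorem IsExponentialType.aemeasurable {X : Ω → ℝ} (hX : IsExponentialType X c μ) :
    AEMeasurable X μ :=
  aemeasurable_of_integrable_exp_mul (v := 0) hX.pos.ne'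
    (hX.integrable_exp_mul c (abs_of_pos hX.pos).le)
    (hX.integrable_exp_mul 0 (by simpa using hX.pos.le))

theorem IsExponentialType.memLp {X : Ω → ℝ} (hX : IsExponentialType X c μ) (p : ℝ) :
    MemLp X (ENNReal.ofReal p) μ := by
  refine memLp_of_mem_interior_integrableExpSet (mem_interior_iff_mem_nhds.2 ?_) p.toNNReal
  filter_upwards [Metric.closedBall_mem_nhds (0 : ℝ) hX.pos] with l hl
  exact hX.integrable_exp_mul l (by simpa using hl)

variable {n : ℕ} {X : Fin n → Ω → ℝ} {θ : EuclideanSpace ℝ (Fin n)}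

theorem memLp_sum_mul (hX : ∀ i, IsExponentialType (X i) c μ) (p : ℝ) :
    MemLp (fun ω => ∑ i, θ i * X i ω) (ENNReal.ofReal p) μ :=
  memLp_finsetSum _ fun i _ => ((hX i).memLp p).const_mul (θ i)

theorem iIndepFun_const_mul (hindep : iIndepFun X μ) : iIndepFun (fun i ω => θ i * X i ω) μ :=
  hindep.comp (fun i x => θ i * x) fun _ => by fun_prop

theorem mgf_sum_mul (hX : ∀ i, AEMeasurable (X i) μ) (hindep : iIndepFun X μ) :
    mgf (fun ω => ∑ i, θ i * X i ω) μ t = ∏ i, mgf (X i) μ (θ i * t) := by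
  simp_rw [← mgf_const_mul]
  rw [← (iIndepFun_const_mul hindep).mgf_sum₀ (fun i => (hX i).const_mul _)]
  congr 1
  ext ω
  simp

theorem sum_sq_mul : ∑ i, (θ i * t) ^ 2 = (t * ‖θ‖) ^ 2 := by
  rw [mul_pow, EuclideanSpace.real_norm_sq_eq, Finset.mul_sum]
  exact Finset.sum_congr rfl fun i _ => by ring

theorem mgf_sum_mul_mem_Icc (hX : ∀ i, IsExponentialType (X i) c μ) (hindep : iIndepFun X μ)
    (ht : |t| * supNorm θ ≤ c) :
    mgf (fun ω => ∑ i, θ i * X i ω) μ t ∈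
      Set.Icc (Real.exp (c * (t * ‖θ‖) ^ 2)) (Real.exp ((t * ‖θ‖) ^ 2 / c)) := by
  have hsmall : ∀ i, |θ i * t| ≤ c := fun i => by
    rw [abs_mul, mul_comm]
    exact (mul_le_mul_of_nonneg_left (abs_apply_le_supNorm θ i) (abs_nonneg t)).trans ht
  rw [mgf_sum_mul (fun i => (hX i).aemeasurable) hindep, ← sum_sq_mul, Finset.mul_sum,
    Finset.sum_div, Real.exp_sum, Real.exp_sum]
  constructor
  · gcongr with i
    exact (hX i).le_mgf _ (hsmall i)
  · gcongr with i
    · exact fun _ _ => mgf_nonneg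
    · exact (hX i).mgf_le _ (hsmall i)

theorem integrable_exp_mul_sum_mul (hX : ∀ i, IsExponentialType (X i) c μ)
    (hindep : iIndepFun X μ) (ht : |t| * supNorm θ ≤ c) :
    Integrable (fun ω => Real.exp (t * ∑ i, θ i * X i ω)) μ :=
  not_imp_comm.1 mgf_undef
    ((Real.exp_pos _).trans_le (mgf_sum_mul_mem_Icc hX hindep ht).1).ne'

theorem momentNorm_sum_mul_le_of_le (hp : 1 ≤ p) (hX : ∀ i, IsExponentialType (X i) c μ)
    (hindep : iIndepFun X μ) {d : ℝ} (hd : 0 < d) (hsup : p * supNorm θ ≤ c * d)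
    (hnorm : √p * ‖θ‖ ≤ d) :
    momentNorm μ (fun ω => ∑ i, θ i * X i ω) p ≤ 2 * Real.exp (1 / c) * d := by
  have hp0 : 0 < p := by linarith
  have hc : 0 ≤ c := nonneg_of_mul_nonneg_left
    ((mul_nonneg hp0.le (supNorm_nonneg θ)).trans hsup) hd
  have ht : |p / d| * supNorm θ ≤ c := by
    rwa [abs_of_pos (by positivity), div_mul_eq_mul_div, div_le_iff₀ hd]
  have ht' : |-(p / d)| * supNorm θ ≤ c := by rwa [abs_neg]
  have hexp : (p / d * ‖θ‖) ^ 2 / c ≤ 1 / c * p :=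
    calc (p / d * ‖θ‖) ^ 2 / c = p * (√p * ‖θ‖ / d) ^ 2 / c := by
          rw [div_pow, mul_pow √p, Real.sq_sqrt hp0.le]
          ring
      _ ≤ p * 1 ^ 2 / c := by
          gcongr
          exact (div_le_one hd).2 hnorm
      _ = 1 / c * p := by ring
  have hmgf := (mgf_sum_mul_mem_Icc hX hindep ht).2
  have hmgf' := (mgf_sum_mul_mem_Icc hX hindep ht').2
  rw [neg_mul, neg_sq] at hmgf'
  calc momentNorm μ (fun ω => ∑ i, θ i * X i ω) p
      ≤ 2 * Real.exp (1 / c) * (p / (p / d)) :=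
        momentNorm_le_of_mgf_le hp (by positivity)
          (integrable_exp_mul_sum_mul hX hindep ht) (integrable_exp_mul_sum_mul hX hindep ht')
          (hmgf.trans (Real.exp_le_exp.2 hexp)) (hmgf'.trans (Real.exp_le_exp.2 hexp))
    _ = 2 * Real.exp (1 / c) * d := by rw [div_div_cancel₀ hp0.ne']

theorem momentNorm_sum_mul_le (hp : 1 ≤ p) (hc : 0 < c) (hX : ∀ i, IsExponentialType (X i) c μ)
    (hindep : iIndepFun X μ) :
    momentNorm μ (fun ω => ∑ i, θ i * X i ω) p
      ≤ 2 * Real.exp (1 / c) * (p * supNorm θ / c + √p * ‖θ‖) := by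
  have hp0 : 0 < p := by linarith
  rcases eq_or_ne θ 0 with rfl | hθ
  · simp [momentNorm, supNorm, hp0.ne']
  have hsup : 0 ≤ p * supNorm θ / c :=
    div_nonneg (mul_nonneg hp0.le (supNorm_nonneg θ)) hc.le
  have hnorm : 0 < √p * ‖θ‖ := by positivity
  refine momentNorm_sum_mul_le_of_le hp hX hindep (by positivity) ?_
    (le_add_of_nonneg_left hsup)
  rw [← div_le_iff₀' hc]
  exact le_add_of_nonneg_right hnorm.le

theorem IsExponentialType.mul_le_momentNorm [IsProbabilityMeasure μ] {X : Ω → ℝ}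
    (hX : IsExponentialType X c μ) (hp : 1 ≤ p) :
    p * (c * Real.exp (-(1 / c))) ≤ momentNorm μ X p := by
  have hc := hX.pos
  have hp0 : 0 < p := by linarith
  have hc1 : c ≤ 1 := by simpa using (hX.le_tail 0 le_rfl).trans measureReal_le_one
  refine mul_le_momentNorm_of_rpow_le_measureReal hp0 (hX.memLp p) hp0.le (by positivity) ?_
  calc (c * Real.exp (-(1 / c))) ^ p = c ^ p * Real.exp (-(p / c)) := by
        rw [Real.mul_rpow hc.le (by positivity), ← Real.exp_mul, neg_mul,
          one_div_mul_eq_div]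
    _ ≤ c * Real.exp (-(p / c)) := by
        gcongr
        exact Real.rpow_le_self_of_le_one hc.le hc1 hp
    _ ≤ μ.real {ω | p ≤ |X ω|} := hX.le_tail p hp0.le

theorem abs_apply_mul_momentNorm_le_momentNorm_sum_mul [IsProbabilityMeasure μ] (hp : 1 ≤ p)
    (hX : ∀ i, IsExponentialType (X i) c μ) (hindep : iIndepFun X μ) (j : Fin n) :
    |θ j| * momentNorm μ (X j) p ≤ momentNorm μ (fun ω => ∑ i, θ i * X i ω) p := by
  have hp1 : 1 ≤ ENNReal.ofReal p := by simpa using hp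
  have hmem : ∀ i, MemLp (fun ω => θ i * X i ω) (ENNReal.ofReal p) μ :=
    fun i => ((hX i).memLp p).const_mul (θ i)
  let Y : Ω → ℝ := ∑ i ∈ Finset.univ.erase j, fun ω => θ i * X i ω
  have hY : MemLp Y (ENNReal.ofReal p) μ := memLp_finsetSum' _ fun i _ => hmem i
  have hY0 : ∫ ω, Y ω ∂μ = 0 := by
    simp only [Y, Finset.sum_apply]
    rw [integral_finsetSum _ fun i _ => (hmem i).integrable hp1]
    exact Finset.sum_eq_zero fun i _ => by
      rw [integral_const_mul, (hX i).integral_eq_zero, mul_zero]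
  have hindepY : IndepFun (fun ω => θ j * X j ω) Y μ :=
    ((iIndepFun_const_mul hindep).indepFun_finsetSum_of_notMem₀ (fun i => (hmem i).1.aemeasurable)
      (Finset.notMem_erase j _)).symm
  calc |θ j| * momentNorm μ (X j) p = momentNorm μ (fun ω => θ j * X j ω) p :=
        (momentNorm_const_mul (by linarith) _).symm
    _ ≤ momentNorm μ ((fun ω => θ j * X j ω) + Y) p :=
        momentNorm_le_momentNorm_add hp (hmem j) hY hindepY hY0
    _ = momentNorm μ (fun ω => ∑ i, θ i * X i ω) p := by
        congr 1
        ext ω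
        simp only [Y, Pi.add_apply, Finset.sum_apply]
        exact Finset.add_sum_erase _ (fun i => θ i * X i ω) (Finset.mem_univ j)

theorem mul_supNorm_le_mul_momentNorm_sum_mul [IsProbabilityMeasure μ] (hp : 1 ≤ p) (hc : 0 < c)
    (hX : ∀ i, IsExponentialType (X i) c μ) (hindep : iIndepFun X μ) :
    p * supNorm θ
      ≤ (c * Real.exp (-(1 / c)))⁻¹ * momentNorm μ (fun ω => ∑ i, θ i * X i ω) p := by
  have hmoment : 0 ≤ momentNorm μ (fun ω => ∑ i, θ i * X i ω) p := by
    unfold momentNorm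
    positivity
  rw [le_inv_mul_iff₀ (by positivity), ← mul_assoc, mul_comm _ p, ← le_div_iff₀' (by positivity)]
  refine (pi_norm_le_iff_of_nonneg (by positivity)).2 fun j => ?_
  rw [le_div_iff₀' (by positivity), mul_comm]
  exact (mul_le_mul_of_nonneg_left ((hX j).mul_le_momentNorm hp) (norm_nonneg _)).trans
    (abs_apply_mul_momentNorm_le_momentNorm_sum_mul hp hX hindep j)

theorem mul_sqrt_mul_norm_le_momentNorm_sum_mul [IsProbabilityMeasure μ] (hp : 1 ≤ p)
    (hc : 0 < c) (hX : ∀ i, IsExponentialType (X i) c μ) (hindep : iIndepFun X μ)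
    (hθ : 2 * √(2 / c) * (√p * supNorm θ) ≤ c * ‖θ‖) :
    Real.exp (-(8 / c ^ 2)) / 4 / √(2 / c) * (√p * ‖θ‖)
      ≤ momentNorm μ (fun ω => ∑ i, θ i * X i ω) p := by
  have hp0 : 0 < p := by linarith
  rcases eq_or_ne θ 0 with rfl | hθ0
  · simp [momentNorm, hp0.ne']
  have hnorm : 0 < ‖θ‖ := norm_pos_iff.2 hθ0
  have hsup := supNorm_nonneg θ
  obtain ⟨t, ht⟩ : ∃ t, t = √(2 / c) * √p / ‖θ‖ := ⟨_, rfl⟩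
  have ht0 : 0 < t := by rw [ht]; positivity
  have ht_sq : (t * ‖θ‖) ^ 2 = 2 / c * p := by
    rw [ht, div_mul_cancel₀ _ hnorm.ne', mul_pow, Real.sq_sqrt (by positivity),
      Real.sq_sqrt hp0.le]
  have ht_two : |2 * t| * supNorm θ ≤ c := by
    rw [abs_of_pos (by positivity), ht, ← mul_div_assoc, div_mul_eq_mul_div, div_le_iff₀ hnorm]
    linarith
  have ht_one : |t| * supNorm θ ≤ c := by
    refine le_trans ?_ ht_two
    gcongr
    linarith
  have hmgf : Real.exp (2 * p) ≤ mgf (fun ω => ∑ i, θ i * X i ω) μ t := by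
    have h := (mgf_sum_mul_mem_Icc hX hindep ht_one).1
    rwa [ht_sq, ← mul_assoc, mul_div_cancel₀ _ hc.ne'] at h
  have hmgf' : mgf (fun ω => ∑ i, θ i * X i ω) μ (2 * t) ≤ Real.exp (8 / c ^ 2 * p) := by
    refine (mgf_sum_mul_mem_Icc hX hindep ht_two).2.trans_eq ?_
    rw [mul_assoc, mul_pow, ht_sq]
    congr 1
    field_simp
    norm_num
  refine le_trans (le_of_eq ?_) (le_momentNorm_of_mgf hp (memLp_sum_mul hX p) ht0
    (integrable_exp_mul_sum_mul hX hindep ht_two) hmgf hmgf')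
  rw [ht]
  field_simp
  rw [Real.sq_sqrt hp0.le]

theorem momentNorm_sum_mul_le_headPart_add_tailPart (hp : 1 ≤ p) (hc : 0 < c)
    (hX : ∀ i, IsExponentialType (X i) c μ) (hindep : iIndepFun X μ) :
    momentNorm μ (fun ω => ∑ i, θ i * X i ω) p
      ≤ 2 * Real.exp (1 / c) * (1 / c + 1)
        * (p * supNorm (headPart θ p) + √p * ‖tailPart θ p‖) := by
  have hp0 : 0 ≤ p := by linarith
  have hnorm : √p * ‖θ‖ ≤ p * supNorm θ + √p * ‖tailPart θ p‖ :=
    calc √p * ‖θ‖ ≤ √p * (√p * supNorm θ + ‖tailPart θ p‖) := by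
          gcongr
          exact norm_le_sqrt_mul_supNorm_add_norm_tailPart θ hp
      _ = p * supNorm θ + √p * ‖tailPart θ p‖ := by
          rw [mul_add, ← mul_assoc, Real.mul_self_sqrt hp0]
  have htail : 0 ≤ 1 / c * (√p * ‖tailPart θ p‖) := by positivity
  rw [supNorm_headPart θ hp]
  calc momentNorm μ (fun ω => ∑ i, θ i * X i ω) p
      ≤ 2 * Real.exp (1 / c) * (p * supNorm θ / c + √p * ‖θ‖) :=
        momentNorm_sum_mul_le hp hc hX hindep
    _ ≤ 2 * Real.exp (1 / c)
          * ((1 / c + 1) * (p * supNorm θ + √p * ‖tailPart θ p‖)) := by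
        gcongr
        rw [div_eq_mul_one_div]
        linarith
    _ = _ := (mul_assoc _ _ _).symm

theorem sqrt_mul_norm_le_mul_momentNorm_sum_mul [IsProbabilityMeasure μ] (hp : 1 ≤ p)
    (hc : 0 < c) (hX : ∀ i, IsExponentialType (X i) c μ) (hindep : iIndepFun X μ) :
    √p * ‖θ‖
      ≤ ((Real.exp (-(8 / c ^ 2)) / 4 / √(2 / c))⁻¹
          + 2 * √(2 / c) / c * (c * Real.exp (-(1 / c)))⁻¹)
        * momentNorm μ (fun ω => ∑ i, θ i * X i ω) p := by
  have hmoment : 0 ≤ momentNorm μ (fun ω => ∑ i, θ i * X i ω) p := by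
    unfold momentNorm
    positivity
  rw [add_mul]
  rcases le_or_gt (2 * √(2 / c) * (√p * supNorm θ)) (c * ‖θ‖) with hθ | hθ
  · refine le_add_of_le_of_nonneg ?_ (by positivity)
    rw [le_inv_mul_iff₀ (by positivity)]
    exact mul_sqrt_mul_norm_le_momentNorm_sum_mul hp hc hX hindep hθ
  · refine le_add_of_nonneg_of_le (by positivity) ?_
    calc √p * ‖θ‖ ≤ √p * (2 * √(2 / c) * (√p * supNorm θ) / c) := by
          gcongr
          exact (le_div_iff₀' hc).2 hθ.le
      _ = 2 * √(2 / c) / c * (√p * √p * supNorm θ) := by ring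
      _ = 2 * √(2 / c) / c * (p * supNorm θ) := by rw [Real.mul_self_sqrt (by linarith)]
      _ ≤ 2 * √(2 / c) / c * ((c * Real.exp (-(1 / c)))⁻¹
            * momentNorm μ (fun ω => ∑ i, θ i * X i ω) p) :=
          mul_le_mul_of_nonneg_left (mul_supNorm_le_mul_momentNorm_sum_mul hp hc hX hindep)
            (by positivity)
      _ = 2 * √(2 / c) / c * (c * Real.exp (-(1 / c)))⁻¹
            * momentNorm μ (fun ω => ∑ i, θ i * X i ω) p := (mul_assoc _ _ _).symm

theorem headPart_add_tailPart_le_mul_momentNorm_sum_mul [IsProbabilityMeasure μ] (hp : 1 ≤ p)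
    (hc : 0 < c) (hX : ∀ i, IsExponentialType (X i) c μ) (hindep : iIndepFun X μ) :
    p * supNorm (headPart θ p) + √p * ‖tailPart θ p‖
      ≤ ((c * Real.exp (-(1 / c)))⁻¹ + ((Real.exp (-(8 / c ^ 2)) / 4 / √(2 / c))⁻¹
          + 2 * √(2 / c) / c * (c * Real.exp (-(1 / c)))⁻¹))
        * momentNorm μ (fun ω => ∑ i, θ i * X i ω) p := by
  rw [supNorm_headPart θ hp, add_mul]
  refine add_le_add (mul_supNorm_le_mul_momentNorm_sum_mul hp hc hX hindep) ?_
  exact (mul_le_mul_of_nonneg_left (norm_tailPart_le θ p) (Real.sqrt_nonneg p)).trans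
    (sqrt_mul_norm_le_mul_momentNorm_sum_mul hp hc hX hindep)

end WeightedSum

theorem exists_momentNorm_sum_mul_bounds {c : ℝ} (hc : 0 < c) :
    ∃ C₁ C₂ : ℝ, 0 < C₁ ∧ 0 < C₂ ∧
      ∀ {n : ℕ} {p : ℝ}, 1 ≤ p → ∀ {θ : EuclideanSpace ℝ (Fin n)} {Ω : Type*}
        [MeasurableSpace Ω] {μ : Measure Ω} [IsProbabilityMeasure μ] {X : Fin n → Ω → ℝ},
        (∀ i, IsExponentialType (X i) c μ) → iIndepFun X μ →
        MemLp (fun ω => ∑ i, θ i * X i ω) (ENNReal.ofReal p) μ ∧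
        C₁ * p * supNorm (headPart θ p) + C₁ * √p * ‖tailPart θ p‖
          ≤ momentNorm μ (fun ω => ∑ i, θ i * X i ω) p ∧
        momentNorm μ (fun ω => ∑ i, θ i * X i ω) p
          ≤ C₂ * p * supNorm (headPart θ p) + C₂ * √p * ‖tailPart θ p‖ := by
  refine ⟨((c * Real.exp (-(1 / c)))⁻¹ + ((Real.exp (-(8 / c ^ 2)) / 4 / √(2 / c))⁻¹
      + 2 * √(2 / c) / c * (c * Real.exp (-(1 / c)))⁻¹))⁻¹, 2 * Real.exp (1 / c) * (1 / c + 1),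
    by positivity, by positivity, @fun n p hp θ Ω _ μ _ X hX hindep =>
      ⟨memLp_sum_mul hX p, ?_⟩⟩
  simp only [mul_assoc _ p, mul_assoc _ √p, ← mul_add]
  rw [inv_mul_le_iff₀ (by positivity)]
  exact ⟨headPart_add_tailPart_le_mul_momentNorm_sum_mul hp hc hX hindep,
    momentNorm_sum_mul_le_headPart_add_tailPart hp hc hX hindep⟩

theorem mul_measureReal_le_measureReal_withDensity {α : Type*} [MeasurableSpace α] {ν : Measure α}
    {f : α → ℝ} [IsFiniteMeasure (ν.withDensity fun x => ENNReal.ofReal (f x))] {m : ℝ}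
    (hm : 0 ≤ m) {u s : Set α} (hu : MeasurableSet u) (hf : ∀ x ∈ u, m ≤ f x) (hus : u ⊆ s) :
    m * ν.real u ≤ (ν.withDensity fun x => ENNReal.ofReal (f x)).real s := by
  refine le_trans ?_ (measureReal_mono hus)
  have hle : ENNReal.ofReal m * ν u ≤ (ν.withDensity fun x => ENNReal.ofReal (f x)) u := by
    rw [withDensity_apply _ hu, ← setLIntegral_const]
    exact setLIntegral_mono' hu fun x hx => ENNReal.ofReal_le_ofReal (hf x hx)
  simpa [Measure.real, ENNReal.toReal_ofReal hm] using ENNReal.toReal_mono (measure_ne_top _ _) hle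

theorem integrable_comp_abs_of_integrableOn_Ioi {E : Type*} [NormedAddCommGroup E] {f : ℝ → E}
    (hf : IntegrableOn f (Set.Ioi 0)) : Integrable fun x => f |x| := by
  have hpos : IntegrableOn (fun x => f |x|) (Set.Ioi 0) :=
    hf.congr_fun (fun x hx => by rw [abs_of_pos hx]) measurableSet_Ioi
  have hneg : IntegrableOn (fun x => f |x|) (Set.Iic 0) := by
    have h : IntegrableOn (fun x => f |x|) (Set.Ici (-0)) := by
      rwa [neg_zero, integrableOn_Ici_iff_integrableOn_Ioi]
    simpa only [abs_neg] using h.comp_neg_Iic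
  rw [← integrableOn_univ, ← Set.Iic_union_Ioi]
  exact hneg.union hpos

section SymmetricExponential

open Topology

theorem integrable_exp_neg_mul_abs {a : ℝ} (ha : 0 < a) :
    Integrable fun x : ℝ => Real.exp (-a * |x|) :=
  integrable_comp_abs_of_integrableOn_Ioi (integrableOn_exp_mul_Ioi (neg_lt_zero.2 ha) 0)

instance isProbabilityMeasure_symmetricExponential :
    IsProbabilityMeasure symmetricExponential := by
  have hmass : ∫ t : ℝ, 1 / 2 * Real.exp (-|t|) = 1 := by
    rw [integral_const_mul, integral_comp_abs (f := fun x => Real.exp (-x)),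
      integral_exp_neg_Ioi_zero]
    norm_num
  have hint : Integrable fun t : ℝ => 1 / 2 * Real.exp (-|t|) :=
    Integrable.of_integral_ne_zero (by rw [hmass]; exact one_ne_zero)
  constructor
  rw [symmetricExponential, withDensity_apply _ MeasurableSet.univ, Measure.restrict_univ,
    ← ofReal_integral_eq_lintegral_ofReal hint (ae_of_all _ fun t => by positivity), hmass,
    ENNReal.ofReal_one]

theorem integral_id_symmetricExponential : ∫ t, t ∂symmetricExponential = 0 := by
  rw [symmetricExponential, integral_withDensity_eq_integral_toReal_smul (by fun_prop)
    (ae_of_all _ fun t => ENNReal.ofReal_lt_top)]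
  have hodd := integral_neg_eq_self
    (fun t : ℝ => (ENNReal.ofReal (1 / 2 * Real.exp (-|t|))).toReal • t) volume
  simp only [abs_neg, smul_neg, integral_neg] at hodd
  linarith

theorem integrable_exp_mul_symmetricExponential {l : ℝ} (hl : |l| < 1) :
    Integrable (fun t => Real.exp (l * t)) symmetricExponential := by
  rw [symmetricExponential, integrable_withDensity_iff_integrable_smul' (by fun_prop)
    (ae_of_all _ fun t => ENNReal.ofReal_lt_top)]
  refine (integrable_exp_neg_mul_abs (sub_pos.2 hl)).mono' (by fun_prop) (ae_of_all _ fun t => ?_)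
  have hlt : l * t ≤ |l| * |t| := (le_abs_self _).trans_eq (abs_mul l t)
  rw [ENNReal.toReal_ofReal (by positivity), smul_eq_mul, mul_assoc, ← Real.exp_add,
    Real.norm_of_nonneg (by positivity)]
  calc 1 / 2 * Real.exp (-|t| + l * t) ≤ Real.exp (-|t| + l * t) := by
        linarith [Real.exp_pos (-|t| + l * t)]
    _ ≤ Real.exp (-(1 - |l|) * |t|) := by
        gcongr
        linarith

theorem exp_le_measureReal_symmetricExponential {t : ℝ} (ht : 0 ≤ t) :
    1 / 2 * Real.exp (-1) * Real.exp (-(1 * t)) ≤ symmetricExponential.real {x | t ≤ |x|} := by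
  have hfin : IsFiniteMeasure
      (volume.withDensity fun t : ℝ => ENNReal.ofReal (1 / 2 * Real.exp (-|t|))) :=
    inferInstanceAs (IsFiniteMeasure symmetricExponential)
  refine le_trans (le_of_eq ?_) (mul_measureReal_le_measureReal_withDensity
    (m := 1 / 2 * Real.exp (-(t + 1))) (u := Set.Icc t (t + 1)) (by positivity)
    measurableSet_Icc (fun x hx => ?_) fun x hx => hx.1.trans (le_abs_self x))
  · rw [Real.volume_real_Icc_of_le (by linarith), mul_assoc, ← Real.exp_add]
    ring_nf
  · gcongr
    exact abs_le.2 ⟨by linarith [hx.1], hx.2⟩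

theorem eventually_isExponentialType_symmetricExponential :
    ∀ᶠ c in 𝓝[>] 0, IsExponentialType (fun t => t) c symmetricExponential := by
  refine eventually_isExponentialType (c₀ := 1 / 2 * Real.exp (-1)) (r := 1)
    (mem_interior_iff_mem_nhds.2 ?_) integral_id_symmetricExponential (by positivity)
    fun t => exp_le_measureReal_symmetricExponential
  filter_upwards [Metric.ball_mem_nhds (0 : ℝ) one_pos] with l hl
  exact integrable_exp_mul_symmetricExponential (by simpa using hl)

end SymmetricExponential

section LogAbsGaussian

open Topology

theorem integrable_abs_rpow_mul_exp_neg_mul_sq {b : ℝ} (hb : 0 < b) {s : ℝ} (hs : -1 < s) :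
    Integrable fun x : ℝ => |x| ^ s * Real.exp (-b * x ^ 2) := by
  simpa only [sq_abs] using integrable_comp_abs_of_integrableOn_Ioi
    (integrable_rpow_mul_exp_neg_mul_sq hb hs).integrableOn

theorem gaussianReal_zero_one_eq_withDensity :
    gaussianReal 0 1 = volume.withDensity fun x => ENNReal.ofReal (gaussianPDFReal 0 1 x) :=
  gaussianReal_of_var_ne_zero 0 one_ne_zero

theorem integrable_abs_rpow_gaussianReal {s : ℝ} (hs : -1 < s) :
    Integrable (fun x : ℝ => |x| ^ s) (gaussianReal 0 1) := by
  rw [gaussianReal_zero_one_eq_withDensity, integrable_withDensity_iff_integrable_smul'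
    (measurable_gaussianPDFReal 0 1).ennreal_ofReal
    (ae_of_all _ fun t => ENNReal.ofReal_lt_top)]
  refine ((integrable_abs_rpow_mul_exp_neg_mul_sq one_half_pos hs).const_mul
    (√(2 * Real.pi))⁻¹).congr (ae_of_all _ fun x => ?_)
  beta_reduce
  rw [ENNReal.toReal_ofReal (gaussianPDFReal_nonneg 0 1 x), smul_eq_mul, gaussianPDFReal]
  simp only [NNReal.coe_one, mul_one, sub_zero]
  ring_nf

theorem zero_mem_interior_integrableExpSet_log_abs_sub (a : ℝ) :
    0 ∈ interior (integrableExpSet (fun z => Real.log |z| - a) (gaussianReal 0 1)) := by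
  refine mem_interior_iff_mem_nhds.2 ?_
  filter_upwards [Ioi_mem_nhds neg_one_lt_zero] with l hl
  refine ((integrable_abs_rpow_gaussianReal hl).mul_const (Real.exp (-(l * a)))).congr ?_
  have hne : ∀ᵐ z ∂gaussianReal 0 1, z ≠ 0 := by
    have := nullSingletonClass_gaussianReal (μ := 0) (v := 1) one_ne_zero
    exact Measure.ae_ne _ 0
  filter_upwards [hne] with z hz
  rw [Real.rpow_def_of_pos (abs_pos.2 hz), ← Real.exp_add]
  ring_nf

theorem integral_log_abs_sub_meanLogAbsGaussian :
    ∫ z, (Real.log |z| - meanLogAbsGaussian) ∂gaussianReal 0 1 = 0 := by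
  have hint : Integrable (fun z => Real.log |z|) (gaussianReal 0 1) := by
    simpa using integrable_of_mem_interior_integrableExpSet
      (zero_mem_interior_integrableExpSet_log_abs_sub 0)
  rw [integral_sub hint (integrable_const _)]
  simp [meanLogAbsGaussian]

theorem exp_le_measureReal_log_abs_sub (a : ℝ) {t : ℝ} (ht : 0 ≤ t) :
    gaussianPDFReal 0 1 (Real.exp a) * (Real.exp a / 2) * Real.exp (-(1 * t))
      ≤ (gaussianReal 0 1).real {z | t ≤ |Real.log (|z|) - a|} := by
  have hfin : IsFiniteMeasure
      (volume.withDensity fun x => ENNReal.ofReal (gaussianPDFReal 0 1 x)) :=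
    gaussianReal_zero_one_eq_withDensity ▸ inferInstance
  have hexp : 0 < Real.exp (a - t) := Real.exp_pos _
  rw [gaussianReal_zero_one_eq_withDensity]
  refine le_trans (le_of_eq ?_) (mul_measureReal_le_measureReal_withDensity
    (u := Set.Icc (Real.exp (a - t) / 2) (Real.exp (a - t)))
    (gaussianPDFReal_nonneg 0 1 (Real.exp a)) measurableSet_Icc (fun x hx => ?_) fun x hx => ?_)
  · rw [Real.volume_real_Icc_of_le (by linarith), sub_eq_add_neg a t, Real.exp_add]
    ring_nf
  · have hx0 : 0 ≤ x := by linarith [hx.1]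
    have hxa : x ≤ Real.exp a := hx.2.trans (Real.exp_le_exp.2 (by linarith))
    simp only [gaussianPDFReal, sub_zero]
    gcongr
  · have hx0 : 0 < x := by linarith [hx.1]
    have hlog : Real.log |x| ≤ a - t := by
      rw [abs_of_pos hx0, Real.log_le_iff_le_exp hx0]
      exact hx.2
    rw [Set.mem_ofPred_eq, abs_sub_comm, le_abs]
    exact .inl (by linarith)

theorem eventually_isExponentialType_log_abs_gaussianReal :
    ∀ᶠ c in 𝓝[>] 0,
      IsExponentialType (fun z => Real.log |z| - meanLogAbsGaussian) c (gaussianReal 0 1) :=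
  eventually_isExponentialType (zero_mem_interior_integrableExpSet_log_abs_sub _)
    integral_log_abs_sub_meanLogAbsGaussian
    (mul_pos (gaussianPDFReal_pos 0 1 _ one_ne_zero) (by positivity))
    fun _ => exp_le_measureReal_log_abs_sub _

end LogAbsGaussian

theorem mainTheorem5_general :
    ∃ C₁ C₂ : ℝ, 0 < C₁ ∧ 0 < C₂ ∧
      ∀ (n : ℕ) (p : ℝ), 1 ≤ p → ∀ (θ : EuclideanSpace ℝ (Fin n)),
      ∀ {Ω : Type*} [MeasurableSpace Ω] (μ : Measure Ω) [IsProbabilityMeasure μ],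
        (∀ Z : Fin n → Ω → ℝ,
          (∀ i, HasLaw (Z i) (gaussianReal 0 1) μ) → iIndepFun Z μ →
          ∀ W : Fin n → Ω → ℝ,
            (∀ i ω, W i ω = Real.log |Z i ω| - meanLogAbsGaussian) →
            MemLp (fun ω => ∑ i, θ i * W i ω) (ENNReal.ofReal p) μ ∧
            C₁ * p * supNorm (headPart θ p) + C₁ * √p * ‖tailPart θ p‖
              ≤ momentNorm μ (fun ω => ∑ i, θ i * W i ω) p ∧
            momentNorm μ (fun ω => ∑ i, θ i * W i ω) p
              ≤ C₂ * p * supNorm (headPart θ p) + C₂ * √p * ‖tailPart θ p‖) ∧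
        (∀ L : Fin n → Ω → ℝ,
          (∀ i, HasLaw (L i) symmetricExponential μ) → iIndepFun L μ →
            MemLp (fun ω => ∑ i, θ i * L i ω) (ENNReal.ofReal p) μ ∧
            C₁ * p * supNorm (headPart θ p) + C₁ * √p * ‖tailPart θ p‖
              ≤ momentNorm μ (fun ω => ∑ i, θ i * L i ω) p ∧
            momentNorm μ (fun ω => ∑ i, θ i * L i ω) p
              ≤ C₂ * p * supNorm (headPart θ p) + C₂ * √p * ‖tailPart θ p‖) := by
  obtain ⟨c, hgauss, hexp⟩ := (eventually_isExponentialType_log_abs_gaussianReal.and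
    eventually_isExponentialType_symmetricExponential).exists
  obtain ⟨C₁, C₂, hC₁, hC₂, hbounds⟩ := exists_momentNorm_sum_mul_bounds hgauss.pos
  refine ⟨C₁, C₂, hC₁, hC₂, fun n p hp θ Ω _ μ _ =>
    ⟨fun Z hZ hZindep W hW => ?_, fun L hL hLindep => ?_⟩⟩
  · obtain rfl : W = fun i ω => Real.log |Z i ω| - meanLogAbsGaussian := funext₂ hW
    exact hbounds hp (fun i => hgauss.comp_hasLaw (by fun_prop) (hZ i))
      (hZindep.comp (fun _ z => Real.log |z| - meanLogAbsGaussian) fun _ => by fun_prop)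
  · exact hbounds hp (fun i => hexp.comp_hasLaw measurable_id (hL i)) hLindep

theorem mainTheorem5 :
    ∃ C₁ C₂ : ℝ, 0 < C₁ ∧ 0 < C₂ ∧
      ∀ (n : ℕ), 1 ≤ n → ∀ (p : ℝ), 1 ≤ p →
      ∀ θ ∈ Metric.sphere (0 : EuclideanSpace ℝ (Fin n)) 1,
      ∀ {Ω : Type*} [MeasurableSpace Ω] (μ : Measure Ω) [IsProbabilityMeasure μ],
        (∀ Z : Fin n → Ω → ℝ,
          (∀ i, HasLaw (Z i) (gaussianReal 0 1) μ) → iIndepFun Z μ →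
          ∀ W : Fin n → Ω → ℝ,
            (∀ i ω, W i ω = Real.log |Z i ω| - meanLogAbsGaussian) →
            MemLp (fun ω => ∑ i, θ i * W i ω) (ENNReal.ofReal p) μ ∧
            C₁ * p * supNorm (headPart θ p) + C₁ * √p * ‖tailPart θ p‖
              ≤ momentNorm μ (fun ω => ∑ i, θ i * W i ω) p ∧
            momentNorm μ (fun ω => ∑ i, θ i * W i ω) p
              ≤ C₂ * p * supNorm (headPart θ p) + C₂ * √p * ‖tailPart θ p‖) ∧
        (∀ L : Fin n → Ω → ℝ,
          (∀ i, HasLaw (L i) symmetricExponential μ) → iIndepFun L μ →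
            MemLp (fun ω => ∑ i, θ i * L i ω) (ENNReal.ofReal p) μ ∧
            C₁ * p * supNorm (headPart θ p) + C₁ * √p * ‖tailPart θ p‖
              ≤ momentNorm μ (fun ω => ∑ i, θ i * L i ω) p ∧
            momentNorm μ (fun ω => ∑ i, θ i * L i ω) p
              ≤ C₂ * p * supNorm (headPart θ p) + C₂ * √p * ‖tailPart θ p‖) := by
  obtain ⟨C₁, C₂, hC₁, hC₂, hbounds⟩ := mainTheorem5_general
  exact ⟨C₁, C₂, hC₁, hC₂, fun n _ p hp θ _ => hbounds n p hp θ⟩
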